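/- Let $n\in\mathbb N$ and let $H_1,H_2$ be $n\times n$ transfer matrices in $\mathcal{RH}_\infty$, i.e. matrices of proper rational functions of $s$ with real coefficients and with no poles in the closed right half-plane $\operatorname{Re}s\ge 0$; write $H_i(j\infty)=\lim_{|s|\to\infty}H_i(s)$. For $A\in\mathbb C^{n\times n}$ let $$\sigma_{\max}(A)=\max_{\|u\|=1}\|Au\|,\qquad \hat\alpha_{\max}(A)=\sup_{\|u\|=1,\ Au\neq 0}\arccos\frac{\operatorname{Re}\langle Au,u\rangle}{\|Au\|\,\|u\|},$$ with Euclidean norms on $\mathbb C^n$ and $\hat\alpha_{\max}(0)=0$. Suppose that for each frequency $\omega\in[0,\infty]$ at least one of the following holds: 1. (phase condition) $\hat\alpha_{\max}(H_1(j\omega))+\hat\alpha_{\max}(H_2(j\omega))<\pi$; 2. (gain condition) $\sigma_{\max}(H_1(j\omega))\,\sigma_{\max}(H_2(j\omega))<1$. Then the negative feedback interconnection $y=H_1e$, $e=u-H_2y$ is $\mathcal L_2$-stable: for $F=\mathbb R$ and for $F=\mathbb C$ there is $\gamma\ge 0$ such that for every input $u\in\mathcal L_2([0,\infty);F^n)$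 there are unique $e,y\in\mathcal L_2([0,\infty);F^n)$ satisfying the loop equations, and $\|e\|\le\gamma\|u\|$, $\|y\|\le\gamma\|u\|$. Here, for $\mathcal L_2$ signals $v,w$, the equation $w=H_iv$ means that the Laplace transforms satisfy $\hat w(s)=H_i(s)\hat v(s)$ for all $\operatorname{Re}s>0$. -/

import Mathlib

open scoped ENNReal NNReal

noncomputable section

namespace MixedGainPhase

/-! ### Transfer matrices -/

/-- Real-rational square transfer matrices `H(s)`. -/
abbrev TransferMatrix (n : ℕ) : Type := Matrix (Fin n) (Fin n) (RatFunc ℝ)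

/-- The space `RH∞`: every entry is proper and has no pole in the closed right half-plane
(`num` and `denom` are coprime and `denom` is monic). -/
def IsRHInf {n : ℕ} (H : TransferMatrix n) : Prop :=
  ∀ i j, (H i j).num.natDegree ≤ (H i j).denom.natDegree ∧
    ∀ s : ℂ, 0 ≤ s.re → Polynomial.aeval s (H i j).denom ≠ 0

/-- The value `H(s)` at a complex point `s` that is not a pole. -/
def evalAt {n : ℕ} (H : TransferMatrix n) (s : ℂ) : Matrix (Fin n) (Fin n) ℂ :=
  H.map (RatFunc.eval (algebraMap ℝ ℂ) s)

/-- The value `H(j∞) = lim_{|s| → ∞} H(s)` of a proper transfer matrix: since `denom` is monic,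
the limit of an entry is the coefficient of `num` at the degree of `denom`. -/
def valueAtInfinity {n : ℕ} (H : TransferMatrix n) : Matrix (Fin n) (Fin n) ℂ :=
  H.map fun r => ((r.num.coeff r.denom.natDegree : ℝ) : ℂ)

/-- The frequency response `H(jω)` at a frequency `ω ∈ [0, ∞]`. -/
def freqResponse {n : ℕ} (H : TransferMatrix n) (ω : ℝ≥0∞) : Matrix (Fin n) (Fin n) ℂ :=
  if ω = ∞ then valueAtInfinity H else evalAt H (Complex.I * (ω.toReal : ℂ))

/-! ### Maximum gain and maximum phase of a matrix -/

/-- `σ_max(A)`, the maximum of `‖Au‖` over unit vectors `u`. -/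
def sigmaMax {n : ℕ} (A : Matrix (Fin n) (Fin n) ℂ) : ℝ :=
  sSup {r : ℝ | ∃ u : EuclideanSpace ℂ (Fin n), ‖u‖ = 1 ∧ r = ‖Matrix.toEuclideanLin A u‖ / ‖u‖}

/-- `α̂_max(A)`, the supremum of the angles between `u` and `Au` over unit vectors `u` with
`Au ≠ 0`. If there is no such `u`, the set is empty and the value is `0`. -/
def alphaMax {n : ℕ} (A : Matrix (Fin n) (Fin n) ℂ) : ℝ :=
  sSup {θ : ℝ | ∃ u : EuclideanSpace ℂ (Fin n), ‖u‖ = 1 ∧ ‖Matrix.toEuclideanLin A u‖ ≠ 0 ∧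
    θ = Real.arccos ((inner ℂ (Matrix.toEuclideanLin A u) u).re /
      (‖Matrix.toEuclideanLin A u‖ * ‖u‖))}

/-! ### Signals on the time axis `[0, ∞)` and `L₂`-stability -/

/-- Lebesgue measure on the time axis `[0, ∞)`. -/
def timeMeasure : MeasureTheory.Measure ℝ :=
  MeasureTheory.volume.restrict (Set.Ici 0)

/-- The inclusion `Fⁿ ⊆ ℂⁿ` for `F = ℝ` or `F = ℂ`. -/
def toComplexVec {F : Type} [RCLike F] {n : ℕ} (v : EuclideanSpace F (Fin n)) :
    EuclideanSpace ℂ (Fin n) :=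
  WithLp.toLp 2 fun i => ((RCLike.re (v i) : ℝ) : ℂ) + ((RCLike.im (v i) : ℝ) : ℂ) * Complex.I

/-- The Laplace transform `∫₀^∞ e^{-st} u(t) dt`. For `u ∈ L₂` and `Re s > 0` the integral
converges absolutely. -/
def laplace {F : Type} [RCLike F] {n : ℕ} (u : ℝ → EuclideanSpace F (Fin n)) (s : ℂ) :
    EuclideanSpace ℂ (Fin n) :=
  ∫ t, Complex.exp (-(s * (t : ℂ))) • toComplexVec (u t) ∂timeMeasure

/-- The `L₂` signal `y` is the output of the causal LTI system with transfer matrix `H` for the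
`L₂` input `u`: the transforms satisfy `ŷ(s) = H(s) û(s)` on the open right half-plane. -/
def IsResponse {F : Type} [RCLike F] {n : ℕ} (H : TransferMatrix n)
    (u y : ℝ → EuclideanSpace F (Fin n)) : Prop :=
  ∀ s : ℂ, 0 < s.re → laplace y s = Matrix.toEuclideanLin (evalAt H s) (laplace u s)

/-- The `L₂` signals `e`, `y` solve the negative feedback loop with external input `u`:
`y = H₁ e` and `e = u - w`, where `w = H₂ y`. -/
structure IsLoopSolution {F : Type} [RCLike F] {n : ℕ} (H₁ H₂ : TransferMatrix n)
    (u e y : ℝ → EuclideanSpace F (Fin n)) : Prop where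
  memLp_error : MeasureTheory.MemLp e 2 timeMeasure
  memLp_output : MeasureTheory.MemLp y 2 timeMeasure
  forward : IsResponse H₁ e y
  feedback : ∃ w : ℝ → EuclideanSpace F (Fin n), MeasureTheory.MemLp w 2 timeMeasure ∧
    IsResponse H₂ y w ∧ ∀ᵐ t ∂timeMeasure, e t = u t - w t

/-- `L₂`-stability over `F`: every input `u ∈ L₂` produces a unique pair of `L₂` loop signals
(up to null sets), and these are bounded by a fixed multiple of the norm of `u`. -/
def IsL2StableOver (F : Type) [RCLike F] {n : ℕ} (H₁ H₂ : TransferMatrix n) : Prop :=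
  ∃ γ : ℝ≥0, ∀ u : ℝ → EuclideanSpace F (Fin n), MeasureTheory.MemLp u 2 timeMeasure →
    ∃ e y : ℝ → EuclideanSpace F (Fin n), IsLoopSolution H₁ H₂ u e y ∧
      MeasureTheory.eLpNorm e 2 timeMeasure ≤ γ * MeasureTheory.eLpNorm u 2 timeMeasure ∧
      MeasureTheory.eLpNorm y 2 timeMeasure ≤ γ * MeasureTheory.eLpNorm u 2 timeMeasure ∧
      ∀ e' y' : ℝ → EuclideanSpace F (Fin n), IsLoopSolution H₁ H₂ u e' y' →
        e' =ᵐ[timeMeasure] e ∧ y' =ᵐ[timeMeasure] y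

/-- The closed loop is `L₂`-stable, for real and for complex signals. -/
def IsClosedLoopL2Stable {n : ℕ} (H₁ H₂ : TransferMatrix n) : Prop :=
  IsL2StableOver ℝ H₁ H₂ ∧ IsL2StableOver ℂ H₁ H₂

end MixedGainPhase

end

/-! A zero of `det (1 + t H₂ H₁)` at a frequency, with `t ∈ [0, 1]`, is a vector `v` that travels
around the loop `v ↦ H₁ v ↦ H₂ H₁ v = -v / t`. The phases picked up then add up to at least `π`, and
the gains multiply to at least `1`, so both conditions exclude it. The determinant has no zero in
the closed right half-plane for `t = 0`, and none can enter as `t` grows to `1`, since it would have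
to cross the extended imaginary axis. Hence `1 + H₂ H₁` is invertible over `RH∞`, and the loop
equations amount to `e = (1 + H₂ H₁)⁻¹ u` and `y = H₁ e`.

Elements of `RH∞` act boundedly on `L₂`: they are generated by the functions `1 / (s - a)` with
`Re a < 0`, which act as convolution with the integrable kernels `e^{at}`. -/

namespace MixedGainPhase

section GainPhase

open Matrix InnerProductGeometry

attribute [local instance] InnerProductSpace.complexToReal

variable {n : ℕ} {A A₁ A₂ : Matrix (Fin n) (Fin n) ℂ} {v : EuclideanSpace ℂ (Fin n)} {t : ℝ}

lemma angle_toEuclideanLin_le_alphaMax (hAv : toEuclideanLin A v ≠ 0) :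
    angle (toEuclideanLin A v) v ≤ alphaMax A := by
  have hv : v ≠ 0 := fun hv => hAv (by rw [hv, map_zero])
  have hpos : 0 < ‖v‖⁻¹ := inv_pos.2 (norm_pos_iff.2 hv)
  have hmap : toEuclideanLin A (‖v‖⁻¹ • v) = ‖v‖⁻¹ • toEuclideanLin A v :=
    (toEuclideanLin A).map_smul_of_tower _ _
  refine le_csSup ⟨Real.pi, ?_⟩ ⟨‖v‖⁻¹ • v, ?_, ?_, ?_⟩
  · rintro _ ⟨u, -, -, rfl⟩
    exact Real.arccos_le_pi _
  · rw [norm_smul, norm_inv, norm_norm, inv_mul_cancel₀ (norm_ne_zero_iff.2 hv)]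
  · rw [hmap, norm_smul]
    simp [hv, hAv]
  · rw [hmap]
    exact ((angle_smul_left_of_pos _ _ hpos).trans (angle_smul_right_of_pos _ _ hpos)).symm

lemma norm_toEuclideanLin_le_sigmaMax :
    ‖toEuclideanLin A v‖ ≤ sigmaMax A * ‖v‖ := by
  rcases eq_or_ne v 0 with rfl | hv
  · simp
  have hmap : toEuclideanLin A (‖v‖⁻¹ • v) = ‖v‖⁻¹ • toEuclideanLin A v :=
    (toEuclideanLin A).map_smul_of_tower _ _
  have hunit : ‖‖v‖⁻¹ • v‖ = 1 := by
    rw [norm_smul, norm_inv, norm_norm, inv_mul_cancel₀ (norm_ne_zero_iff.2 hv)]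
  rw [← div_le_iff₀ (norm_pos_iff.2 hv)]
  refine le_csSup ⟨‖LinearMap.toContinuousLinearMap (toEuclideanLin A)‖, ?_⟩
    ⟨‖v‖⁻¹ • v, hunit, ?_⟩
  · rintro _ ⟨u, hu, rfl⟩
    simpa [hu] using (LinearMap.toContinuousLinearMap (toEuclideanLin A)).le_opNorm u
  · rw [hmap, hunit, norm_smul, norm_inv, norm_norm, div_one, div_eq_inv_mul]

lemma sigmaMax_nonneg : 0 ≤ sigmaMax A := by
  refine Real.sSup_nonneg ?_
  rintro _ ⟨u, -, rfl⟩
  positivity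

-- The two angles along the loop `v ↦ A₁ v ↦ A₂ (A₁ v) = -v / t` add up to `π`.
lemma pi_le_alphaMax_add_alphaMax (hv : v ≠ 0) (ht : 0 ≤ t)
    (hloop : v = -(t • toEuclideanLin A₂ (toEuclideanLin A₁ v))) :
    Real.pi ≤ alphaMax A₁ + alphaMax A₂ := by
  set y := toEuclideanLin A₁ v
  set w := toEuclideanLin A₂ y with hw
  have ht' : 0 < t := ht.lt_of_ne' fun h => hv (by rw [hloop, h, zero_smul, neg_zero])
  have hw0 : w ≠ 0 := fun h => hv (by rw [hloop, h, smul_zero, neg_zero])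
  have hy0 : y ≠ 0 := fun h => hw0 (by rw [hw, h, map_zero])
  have hsum : angle y v = Real.pi - angle w y := by
    rw [hloop, angle_neg_right, angle_smul_right_of_pos _ _ ht', angle_comm]
  linarith [angle_toEuclideanLin_le_alphaMax hy0, angle_toEuclideanLin_le_alphaMax hw0]

lemma one_le_sigmaMax_mul_sigmaMax (hv : v ≠ 0) (ht : t ∈ Set.Icc (0 : ℝ) 1)
    (hloop : v = -(t • toEuclideanLin A₂ (toEuclideanLin A₁ v))) :
    1 ≤ sigmaMax A₁ * sigmaMax A₂ := by
  refine le_of_mul_le_mul_right ?_ (norm_pos_iff.2 hv)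
  calc 1 * ‖v‖ = t * ‖toEuclideanLin A₂ (toEuclideanLin A₁ v)‖ := by
        conv_lhs => rw [hloop, norm_neg, norm_smul, Real.norm_of_nonneg ht.1, one_mul]
    _ ≤ ‖toEuclideanLin A₂ (toEuclideanLin A₁ v)‖ := mul_le_of_le_one_left (norm_nonneg _) ht.2
    _ ≤ sigmaMax A₂ * ‖toEuclideanLin A₁ v‖ := norm_toEuclideanLin_le_sigmaMax
    _ ≤ sigmaMax A₂ * (sigmaMax A₁ * ‖v‖) :=
        mul_le_mul_of_nonneg_left norm_toEuclideanLin_le_sigmaMax sigmaMax_nonneg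
    _ = sigmaMax A₁ * sigmaMax A₂ * ‖v‖ := by ring

lemma exists_loop_of_det_one_add_smul_mul_eq_zero (h : (1 + t • (A₂ * A₁)).det = 0) :
    ∃ v : EuclideanSpace ℂ (Fin n), v ≠ 0 ∧
      v = -(t • toEuclideanLin A₂ (toEuclideanLin A₁ v)) := by
  obtain ⟨v, hv, hmul⟩ := exists_mulVec_eq_zero_iff.2 h
  refine ⟨WithLp.toLp 2 v, by simpa using hv, ?_⟩
  rw [add_mulVec, one_mulVec, smul_mulVec, ← mulVec_mulVec] at hmul
  ext i
  exact eq_neg_of_add_eq_zero_left (congrFun hmul i)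

lemma det_one_add_smul_mul_ne_zero
    (h : alphaMax A₁ + alphaMax A₂ < Real.pi ∨ sigmaMax A₁ * sigmaMax A₂ < 1)
    (ht : t ∈ Set.Icc (0 : ℝ) 1) : (1 + t • (A₂ * A₁)).det ≠ 0 := by
  intro hdet
  obtain ⟨v, hv, hloop⟩ := exists_loop_of_det_one_add_smul_mul_eq_zero hdet
  rcases h with hphase | hgain
  · exact hphase.not_ge (pi_le_alphaMax_add_alphaMax hv ht.1 hloop)
  · exact hgain.not_ge (one_le_sigmaMax_mul_sigmaMax hv ht hloop)

end GainPhase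

section Homotopy

open Topology

variable {X Y E : Type*} [TopologicalSpace X] [TopologicalSpace Y] [CompactSpace Y]
  [NormedAddCommGroup E] {f : X → Y → E}

lemma isOpen_setOf_forall_ne_zero (hf : Continuous f.uncurry) :
    IsOpen {x | ∀ y, f x y ≠ 0} := by
  have hzero : IsClosed {z : X × Y | f.uncurry z = 0} := isClosed_eq hf continuous_const
  convert (isClosedMap_fst_of_compactSpace _ hzero).isOpen_compl using 1
  ext x
  simp

lemma exists_forall_le_norm_of_isCompact [CompactSpace X] {B : Set Y} (hf : Continuous f.uncurry)
    (hB : IsClosed B) (h : ∀ x, ∀ y ∈ B, f x y ≠ 0) :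
    ∃ c > 0, ∀ x, ∀ y ∈ B, c ≤ ‖f x y‖ := by
  obtain ⟨c, hc, hle⟩ := (isCompact_univ.prod hB.isCompact).exists_forall_le'
    hf.norm.continuousOn (a := 0) fun z hz => norm_pos_iff.2 (h z.1 z.2 hz.2)
  exact ⟨c, hc, fun x y hy => hle (x, y) ⟨Set.mem_univ x, hy⟩⟩

-- By compactness the nonvanishing `f x` are uniformly bounded below on `B`, hence everywhere by the
-- minimum principle; so nonvanishing is both an open and a closed condition on `x`.
lemma forall_ne_zero_of_minimum_principle [CompactSpace X] [PreconnectedSpace X] {B : Set Y}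
    (hf : Continuous f.uncurry) (hB : IsClosed B) (hfB : ∀ x, ∀ y ∈ B, f x y ≠ 0)
    (hmin : ∀ x, (∀ y, f x y ≠ 0) → ∀ c > 0, (∀ y ∈ B, c ≤ ‖f x y‖) → ∀ y, c ≤ ‖f x y‖)
    {x₀ : X} (hx₀ : ∀ y, f x₀ y ≠ 0) (x : X) (y : Y) : f x y ≠ 0 := by
  obtain ⟨c, hc, hcB⟩ := exists_forall_le_norm_of_isCompact hf hB hfB
  have hset : {x | ∀ y, f x y ≠ 0} = {x | ∀ y, c ≤ ‖f x y‖} := by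
    ext x
    exact ⟨fun hx => hmin x hx c hc (hcB x), fun hx y => norm_pos_iff.1 (hc.trans_le (hx y))⟩
  have hclosed : IsClosed {x | ∀ y, c ≤ ‖f x y‖} := by
    simp only [Set.ofPred_forall]
    exact isClosed_iInter fun y =>
      isClosed_le continuous_const (hf.comp (Continuous.prodMk_left y)).norm
  have hclopen : IsClopen {x | ∀ y, f x y ≠ 0} :=
    ⟨hset ▸ hclosed, isOpen_setOf_forall_ne_zero hf⟩
  exact (hclopen.eq_univ ⟨x₀, hx₀⟩ ▸ Set.mem_univ x : x ∈ {x | ∀ y, f x y ≠ 0}) y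

end Homotopy

section StableRationalFunctions

open Complex Filter Topology Bornology Polynomial

lemma tendsto_eval_div_eval_cobounded {K : Type*} [NormedField K] {p q : K[X]}
    (hq : q.Monic) (hpq : p.natDegree ≤ q.natDegree) :
    Tendsto (fun s => p.eval s / q.eval s) (cobounded K) (𝓝 (p.coeff q.natDegree)) := by
  set c := p.coeff q.natDegree
  have hdeg : (p - C c * q).degree < q.degree := by
    refine (degree_lt_iff_coeff_zero _ _).2 ?_ |>.trans_eq (degree_eq_natDegree hq.ne_zero).symm
    intro m hm
    rcases hm.eq_or_lt with rfl | hlt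
    · simp [c, hq.coeff_natDegree]
    · simp [coeff_eq_zero_of_natDegree_lt hlt, coeff_eq_zero_of_natDegree_lt (hpq.trans_lt hlt)]
  have hlim := (isLittleO_cobounded_of_degree_lt hdeg).tendsto_div_nhds_zero
  have hroots : ∀ᶠ s in cobounded K, q.eval s ≠ 0 :=
    (le_cofinite K) (eventually_cofinite_not_isRoot hq.ne_zero)
  refine (by simpa using hlim.add_const c : Tendsto _ _ (𝓝 c)).congr' ?_
  filter_upwards [hroots] with s hs
  simp [sub_div, hs]

lemma aeval_ne_zero_of_dvd {K L : Type*} [CommRing K] [CommRing L] [Algebra K L] {p q : K[X]}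
    {s : L} (h : p ∣ q) (hq : aeval s q ≠ 0) : aeval s p ≠ 0 :=
  fun hp => hq (aeval_eq_zero_of_dvd_aeval_eq_zero h hp)

lemma intDegree_add_nonpos {K : Type*} [Field K] {q r : RatFunc K} (hq : q.intDegree ≤ 0)
    (hr : r.intDegree ≤ 0) : (q + r).intDegree ≤ 0 := by
  rcases eq_or_ne r 0 with rfl | hr0
  · simpa using hq
  rcases eq_or_ne (q + r) 0 with hqr | hqr
  · simp [hqr]
  exact (RatFunc.intDegree_add_le hr0 hqr).trans (max_le hq hr)

lemma intDegree_mul_nonpos {K : Type*} [Field K] {q r : RatFunc K} (hq : q.intDegree ≤ 0)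
    (hr : r.intDegree ≤ 0) : (q * r).intDegree ≤ 0 := by
  rcases eq_or_ne q 0 with rfl | hq0
  · simp
  rcases eq_or_ne r 0 with rfl | hr0
  · simp
  exact (RatFunc.intDegree_mul hq0 hr0).trans_le (add_nonpos hq hr)

lemma intDegree_nonpos_iff {K : Type*} [Field K] {r : RatFunc K} :
    r.intDegree ≤ 0 ↔ r.num.natDegree ≤ r.denom.natDegree := by
  rw [RatFunc.intDegree, sub_nonpos, Nat.cast_le]

/-- The ring `RH∞` of proper real-rational functions without poles in the closed right
half-plane. -/
def RHInf : Subalgebra ℝ (RatFunc ℝ) where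
  carrier := {r | r.num.natDegree ≤ r.denom.natDegree ∧ ∀ s : ℂ, 0 ≤ s.re → aeval s r.denom ≠ 0}
  mul_mem' {q r} hq hr :=
    ⟨intDegree_nonpos_iff.1 (intDegree_mul_nonpos (intDegree_nonpos_iff.2 hq.1)
      (intDegree_nonpos_iff.2 hr.1)), fun s hs =>
      aeval_ne_zero_of_dvd (RatFunc.denom_mul_dvd q r)
        (by simpa using ⟨hq.2 s hs, hr.2 s hs⟩)⟩
  add_mem' {q r} hq hr :=
    ⟨intDegree_nonpos_iff.1 (intDegree_add_nonpos (intDegree_nonpos_iff.2 hq.1)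
      (intDegree_nonpos_iff.2 hr.1)), fun s hs =>
      aeval_ne_zero_of_dvd (RatFunc.denom_add_dvd q r)
        (by simpa using ⟨hq.2 s hs, hr.2 s hs⟩)⟩
  algebraMap_mem' c := by
    simp [RatFunc.algebraMap_eq_C]

/-- The closed right half-plane `Re s ≥ 0`. Its one-point compactification carries the values of the
elements of `RH∞`, the added point being `j∞`. -/
abbrev closedRHP : Set ℂ := {s | 0 ≤ s.re}

lemma isClosed_closedRHP : IsClosed closedRHP := isClosed_le continuous_const continuous_re

lemma tendsto_coe_closedRHP :
    Tendsto ((↑) : closedRHP → ℂ) (coclosedCompact closedRHP) (cobounded ℂ) := by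
  rw [coclosedCompact_eq_cocompact, Metric.cobounded_eq_cocompact]
  exact isClosed_closedRHP.isClosedEmbedding_subtypeVal.tendsto_cocompact

instance : NoncompactSpace closedRHP := by
  refine ⟨fun hcompact => ?_⟩
  obtain ⟨C, hC⟩ := (hcompact.image continuous_subtype_val).isBounded.exists_norm_le
  have hmem : (((max C 0 + 1 : ℝ) : ℂ)) ∈ Subtype.val '' (Set.univ : Set closedRHP) :=
    ⟨⟨_, show 0 ≤ max C 0 + 1 by positivity⟩, Set.mem_univ _, rfl⟩
  have hle := (le_abs_self _).trans_eq (norm_real _).symm |>.trans (hC _ hmem)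
  linarith [le_max_left C 0]

lemma differentiableAt_eval (r : RHInf) (s : closedRHP) :
    DifferentiableAt ℂ (fun z => (r : RatFunc ℝ).eval (algebraMap ℝ ℂ) z) s := by
  simp only [RatFunc.eval, ← aeval_def]
  exact (Polynomial.differentiableAt_aeval _).div (Polynomial.differentiableAt_aeval _)
    (r.2.2 s s.2)

lemma tendsto_eval_cobounded (r : RHInf) :
    Tendsto (fun s => (r : RatFunc ℝ).eval (algebraMap ℝ ℂ) s) (cobounded ℂ)
      (𝓝 ((r : RatFunc ℝ).num.coeff (r : RatFunc ℝ).denom.natDegree : ℝ)) := by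
  have hmonic := (RatFunc.monic_denom (r : RatFunc ℝ)).map (algebraMap ℝ ℂ)
  have hlim := tendsto_eval_div_eval_cobounded hmonic
    (p := (r : RatFunc ℝ).num.map (algebraMap ℝ ℂ)) (by simpa using r.2.1)
  simpa [RatFunc.eval, eval₂_eq_eval_map] using hlim

/-- The values of `r ∈ RH∞` on the compactified closed right half-plane. -/
noncomputable def extendedEval (r : RHInf) : C(OnePoint closedRHP, ℂ) :=
  OnePoint.continuousMapMk
    ⟨fun s => (r : RatFunc ℝ).eval (algebraMap ℝ ℂ) s, continuous_iff_continuousAt.2 fun s =>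
      (differentiableAt_eval r s).continuousAt.comp continuous_subtype_val.continuousAt⟩
    ((r : RatFunc ℝ).num.coeff (r : RatFunc ℝ).denom.natDegree : ℝ)
    ((tendsto_eval_cobounded r).comp tendsto_coe_closedRHP)

lemma continuousMap_ext_coe {φ ψ : C(OnePoint closedRHP, ℂ)} (h : ∀ s : closedRHP, φ s = ψ s) :
    φ = ψ :=
  DFunLike.coe_injective (OnePoint.denseRange_coe.equalizer φ.continuous ψ.continuous (funext h))

/-- Evaluation on the compactified closed right half-plane as a homomorphism. Multiplicativity
at `j∞` follows from that at finite points by density. -/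
noncomputable def evalHom : RHInf →ₐ[ℝ] C(OnePoint closedRHP, ℂ) where
  toFun := extendedEval
  map_zero' := continuousMap_ext_coe fun _ => RatFunc.eval_zero _ _
  map_one' := continuousMap_ext_coe fun _ => RatFunc.eval_one _ _
  map_add' q r := continuousMap_ext_coe fun s =>
    RatFunc.eval_add _ _ (q.2.2 s s.2) (r.2.2 s s.2)
  map_mul' q r := continuousMap_ext_coe fun s =>
    RatFunc.eval_mul _ _ (q.2.2 s s.2) (r.2.2 s s.2)
  commutes' _ := continuousMap_ext_coe fun s => RatFunc.eval_C (algebraMap ℝ ℂ) (s : ℂ)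

lemma evalHom_coe (r : RHInf) (s : closedRHP) :
    evalHom r s = (r : RatFunc ℝ).eval (algebraMap ℝ ℂ) s := rfl

lemma isUnit_of_evalHom_ne_zero {r : RHInf} (h : ∀ z, evalHom r z ≠ 0) : IsUnit r := by
  have hcoeff : (r : RatFunc ℝ).num.coeff (r : RatFunc ℝ).denom.natDegree ≠ 0 :=
    ofReal_ne_zero.1 (h OnePoint.infty)
  have hr : (r : RatFunc ℝ) ≠ 0 := fun hr => hcoeff (by simp [hr])
  have hnum (s : closedRHP) : aeval (s : ℂ) (r : RatFunc ℝ).num ≠ 0 := fun hs =>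
    h s (div_eq_zero_iff.2 (Or.inl hs))
  have hinv : (r : RatFunc ℝ)⁻¹ ∈ RHInf := by
    refine ⟨intDegree_nonpos_iff.1 ?_, fun s hs =>
      aeval_ne_zero_of_dvd (RatFunc.denom_inv_dvd hr) (hnum ⟨s, hs⟩)⟩
    rw [RatFunc.intDegree_inv, RatFunc.intDegree, neg_sub, sub_nonpos, Nat.cast_le]
    exact le_natDegree_of_ne_zero hcoeff
  exact IsUnit.of_mul_eq_one ⟨_, hinv⟩ (Subtype.ext (mul_inv_cancel₀ hr))

lemma eval_conj (r : RatFunc ℝ) (s : ℂ) :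
    r.eval (algebraMap ℝ ℂ) (starRingEnd ℂ s) =
      starRingEnd ℂ (r.eval (algebraMap ℝ ℂ) s) := by
  simp only [RatFunc.eval, ← aeval_def, aeval_conj, map_div₀]

/-- The extended imaginary axis `jℝ ∪ {j∞}`. -/
def extendedImaginaryAxis : Set (OnePoint closedRHP) :=
  ((↑) '' {s : closedRHP | 0 < (s : ℂ).re})ᶜ

lemma isClosed_extendedImaginaryAxis : IsClosed extendedImaginaryAxis := by
  refine (OnePoint.isOpen_image_coe.2 ?_).isClosed_compl
  exact isOpen_lt continuous_const (continuous_re.comp continuous_subtype_val)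

lemma forall_mem_extendedImaginaryAxis {P : OnePoint closedRHP → Prop} :
    (∀ z ∈ extendedImaginaryAxis, P z) ↔
      P OnePoint.infty ∧ ∀ ω : ℝ, P ↑(⟨ω * I, by simp⟩ : closedRHP) := by
  have hinfty : OnePoint.infty ∈ extendedImaginaryAxis := by simp [extendedImaginaryAxis]
  have hcoe (s : closedRHP) :
      (s : OnePoint closedRHP) ∈ extendedImaginaryAxis ↔ (s : ℂ).re = 0 := by
    simpa [extendedImaginaryAxis] using ⟨fun h => h.antisymm s.2, Eq.le⟩
  refine ⟨fun h => ⟨h _ hinfty, fun ω => h _ ((hcoe _).2 (by simp))⟩, fun h z hz => ?_⟩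
  induction z using OnePoint.rec with
  | infty => exact h.1
  | coe s =>
    convert h.2 (s : ℂ).im
    exact Complex.ext (by simpa using (hcoe s).1 hz) (by simp)

lemma norm_evalHom_le {r : RHInf} {C : ℝ} (h : ∀ z ∈ extendedImaginaryAxis, ‖evalHom r z‖ ≤ C) :
    ∀ z, ‖evalHom r z‖ ≤ C := by
  rw [forall_mem_extendedImaginaryAxis] at h
  have hbdd (s : closedRHP) : ‖(r : RatFunc ℝ).eval (algebraMap ℝ ℂ) s‖ ≤ ‖evalHom r‖ :=
    (evalHom r).norm_coe_le_norm s
  have hsub : {z : ℂ | 0 < z.re} ⊆ closedRHP := fun z (hz : 0 < z.re) => hz.le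
  refine OnePoint.forall.2 ⟨h.1, fun s => ?_⟩
  refine PhragmenLindelof.right_half_plane_of_bounded_on_real
    (f := fun s => (r : RatFunc ℝ).eval (algebraMap ℝ ℂ) s)
    ?_ ⟨0, two_pos, 0, ?_⟩ ⟨‖evalHom r‖, ?_⟩ h.2 s.2
  · refine DifferentiableOn.diffContOnCl fun z hz => ?_
    rw [closure_setOfPred_lt_re] at hz
    exact (differentiableAt_eval r ⟨z, hz⟩).differentiableWithinAt
  · refine Asymptotics.IsBigO.of_bound ‖evalHom r‖ (eventually_inf_principal.2 ?_)
    exact Eventually.of_forall fun z hz => by simpa using hbdd ⟨z, hsub hz⟩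
  · rw [eventually_map]
    filter_upwards [eventually_ge_atTop 0] with x hx
    exact hbdd ⟨x, by simpa using hx⟩

lemma le_norm_evalHom {r : RHInf} (hr : ∀ z, evalHom r z ≠ 0) {c : ℝ} (hc : 0 < c)
    (h : ∀ z ∈ extendedImaginaryAxis, c ≤ ‖evalHom r z‖) (z : OnePoint closedRHP) :
    c ≤ ‖evalHom r z‖ := by
  obtain ⟨u, rfl⟩ := isUnit_of_evalHom_ne_zero hr
  have hinv (z) : evalHom (↑u⁻¹ : RHInf) z = (evalHom u z)⁻¹ :=
    eq_inv_of_mul_eq_one_left (by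
      rw [← ContinuousMap.mul_apply, ← map_mul, u.inv_mul, map_one, ContinuousMap.one_apply])
  have hle := norm_evalHom_le (r := ↑u⁻¹) (C := c⁻¹) (fun z hz => by
    rw [hinv, norm_inv]
    exact inv_anti₀ hc (h z hz)) z
  rwa [hinv, norm_inv, inv_le_inv₀ (norm_pos_iff.2 (hr z)) hc] at hle

/-- The point `jω` of the extended imaginary axis, for a frequency `ω ∈ [0, ∞]`. -/
noncomputable def frequencyPoint (ω : ℝ≥0∞) : OnePoint closedRHP :=
  if ω = ∞ then OnePoint.infty else ↑(⟨I * ω.toReal, by simp⟩ : closedRHP)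

-- The values at `-jω` are the conjugates of those at `jω`.
lemma evalHom_ne_zero_of_frequencyPoint {r : RHInf}
    (h : ∀ ω, evalHom r (frequencyPoint ω) ≠ 0) :
    ∀ z ∈ extendedImaginaryAxis, evalHom r z ≠ 0 := by
  have hnonneg {ω : ℝ} (hω : 0 ≤ ω) : (r : RatFunc ℝ).eval (algebraMap ℝ ℂ) (ω * I) ≠ 0 := by
    have hfreq := h (ENNReal.ofReal ω)
    rw [frequencyPoint, if_neg ENNReal.ofReal_ne_top, evalHom_coe] at hfreq
    simpa only [ENNReal.toReal_ofReal hω, mul_comm] using hfreq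
  refine forall_mem_extendedImaginaryAxis.2
    ⟨by simpa only [frequencyPoint, if_pos] using h ∞, fun ω => ?_⟩
  rcases le_total 0 ω with hω | hω
  · exact hnonneg hω
  · have hconj : (ω : ℂ) * I = starRingEnd ℂ ((-ω : ℝ) * I) := by simp
    change (r : RatFunc ℝ).eval (algebraMap ℝ ℂ) (ω * I) ≠ 0
    rw [hconj, eval_conj, _root_.map_ne_zero]
    exact hnonneg (neg_nonneg.2 hω)

end StableRationalFunctions

section ReturnDifference

open Matrix unitInterval

variable {ι : Type*} [Fintype ι] [DecidableEq ι]

/-- The value of `r ∈ RH∞` at a point of the compactified closed right half-plane. -/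
noncomputable def valueAt (z : OnePoint closedRHP) : RHInf →ₐ[ℝ] ℂ :=
  (ContinuousMap.evalAlgHom ℝ ℂ z).comp evalHom

lemma evalHom_det_one_add_smul (M : Matrix ι ι RHInf) (t : ℝ) (z : OnePoint closedRHP) :
    evalHom (1 + t • M).det z = (1 + t • M.map (valueAt z)).det := by
  change valueAt z _ = _
  rw [AlgHom.map_det, map_add, map_one, map_smul, AlgHom.mapMatrix_apply]

lemma isUnit_one_add_of_det_ne_zero {M : Matrix ι ι RHInf}
    (h : ∀ t ∈ Set.Icc (0 : ℝ) 1, ∀ ω,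
      (1 + t • M.map (valueAt (frequencyPoint ω))).det ≠ 0) : IsUnit (1 + M) := by
  have hcont : Continuous fun p : I × OnePoint closedRHP =>
      evalHom (1 + (p.1 : ℝ) • M).det p.2 := by
    simp only [evalHom_det_one_add_smul]
    have hM : Continuous fun p : I × OnePoint closedRHP => M.map (valueAt p.2) :=
      continuous_matrix fun i j => (evalHom (M i j)).continuous.comp continuous_snd
    exact (continuous_const.add
      ((continuous_subtype_val.comp continuous_fst).smul hM)).matrix_det
  have hne := forall_ne_zero_of_minimum_principle
    (f := fun (t : I) z => evalHom (1 + (t : ℝ) • M).det z) hcont isClosed_extendedImaginaryAxis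
    (fun t => evalHom_ne_zero_of_frequencyPoint fun ω => by
      rw [evalHom_det_one_add_smul]; exact h t t.2 ω)
    (fun t ht c hc hle z => le_norm_evalHom ht hc hle z) (x₀ := 0) (fun z => by simp) 1
  rw [isUnit_iff_isUnit_det]
  exact isUnit_of_evalHom_ne_zero (by simpa using hne)

variable {n : ℕ}

/-- A transfer matrix over `RH∞` as a real-rational matrix. -/
noncomputable def toTransferMatrix (M : Matrix (Fin n) (Fin n) RHInf) : TransferMatrix n :=
  RHInf.val.mapMatrix M

lemma exists_toTransferMatrix_eq {H : TransferMatrix n} (hH : IsRHInf H) :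
    ∃ M, toTransferMatrix M = H :=
  ⟨Matrix.of fun i j => ⟨H i j, hH i j⟩, rfl⟩

lemma freqResponse_toTransferMatrix (M : Matrix (Fin n) (Fin n) RHInf) (ω : ℝ≥0∞) :
    freqResponse (toTransferMatrix M) ω = M.map (valueAt (frequencyPoint ω)) := by
  unfold freqResponse frequencyPoint
  split_ifs <;> rfl

theorem isUnit_one_add_mul {M₁ M₂ : Matrix (Fin n) (Fin n) RHInf}
    (h : ∀ ω : ℝ≥0∞,
      alphaMax (freqResponse (toTransferMatrix M₁) ω) +
          alphaMax (freqResponse (toTransferMatrix M₂) ω) < Real.pi ∨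
        sigmaMax (freqResponse (toTransferMatrix M₁) ω) *
          sigmaMax (freqResponse (toTransferMatrix M₂) ω) < 1) :
    IsUnit (1 + M₂ * M₁) := by
  refine isUnit_one_add_of_det_ne_zero fun t ht ω => ?_
  rw [Matrix.map_mul]
  simp only [freqResponse_toTransferMatrix] at h
  exact det_one_add_smul_mul_ne_zero (h ω) ht

end ReturnDifference

section Laplace

open Complex MeasureTheory Set FourierTransform

variable {E : Type*} [NormedAddCommGroup E] [NormedSpace ℂ E]

/-- The Laplace transform of a signal on `[0, ∞)` with values in a complex normed space. -/
noncomputable def laplaceTransform (u : ℝ → E) (s : ℂ) : E :=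
  ∫ t, exp (-(s * (t : ℂ))) • u t ∂timeMeasure

lemma memLp_exp_neg_mul {s : ℂ} (hs : 0 < s.re) :
    MemLp (fun t : ℝ => exp (-(s * (t : ℂ)))) 2 timeMeasure := by
  rw [memLp_two_iff_integrable_sq_norm (by fun_prop)]
  have hexp := (integrableOn_Ici_iff_integrableOn_Ioi).2
    (integrableOn_exp_mul_Ioi (a := -(2 * s.re)) (by linarith) 0)
  refine hexp.congr (ae_of_all _ fun t => ?_)
  simp only [norm_exp, ← Real.exp_nat_mul, neg_re, re_mul_ofReal, Nat.cast_ofNat]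
  ring_nf

lemma integrable_exp_smul_of_memLp_two {u : ℝ → E} (hu : MemLp u 2 timeMeasure) {s : ℂ}
    (hs : 0 < s.re) : Integrable (fun t : ℝ => exp (-(s * (t : ℂ))) • u t) timeMeasure :=
  memLp_one_iff_integrable.1 (hu.smul (memLp_exp_neg_mul hs))

lemma laplaceTransform_add {u v : ℝ → E} (hu : MemLp u 2 timeMeasure)
    (hv : MemLp v 2 timeMeasure) {s : ℂ} (hs : 0 < s.re) :
    laplaceTransform (u + v) s = laplaceTransform u s + laplaceTransform v s := by
  simp only [laplaceTransform, Pi.add_apply, smul_add]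
  exact integral_add (integrable_exp_smul_of_memLp_two hu hs)
    (integrable_exp_smul_of_memLp_two hv hs)

lemma laplaceTransform_sub {u v : ℝ → E} (hu : MemLp u 2 timeMeasure)
    (hv : MemLp v 2 timeMeasure) {s : ℂ} (hs : 0 < s.re) :
    laplaceTransform (u - v) s = laplaceTransform u s - laplaceTransform v s := by
  simp only [laplaceTransform, Pi.sub_apply, smul_sub]
  exact integral_sub (integrable_exp_smul_of_memLp_two hu hs)
    (integrable_exp_smul_of_memLp_two hv hs)

lemma laplaceTransform_smul (c : ℂ) (u : ℝ → E) (s : ℂ) :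
    laplaceTransform (c • u) s = c • laplaceTransform u s := by
  simp only [laplaceTransform, Pi.smul_apply, smul_comm _ c, integral_smul]

lemma laplaceTransform_congr_ae {u v : ℝ → E} (h : u =ᵐ[timeMeasure] v) :
    laplaceTransform u = laplaceTransform v := by
  ext s
  refine integral_congr_ae ?_
  filter_upwards [h] with t ht
  rw [ht]

lemma laplaceTransform_clm_comp [CompleteSpace E] {F : Type*}
    [NormedAddCommGroup F] [NormedSpace ℂ F] [CompleteSpace F] (L : E →L[ℂ] F) {u : ℝ → E}
    (hu : MemLp u 2 timeMeasure) {s : ℂ} (hs : 0 < s.re) :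
    laplaceTransform (L ∘ u) s = L (laplaceTransform u s) := by
  rw [laplaceTransform, laplaceTransform,
    ← L.integral_comp_comm (integrable_exp_smul_of_memLp_two hu hs)]
  simp only [Function.comp_apply, map_smul]

lemma ae_eq_zero_of_fourier_eq_zero [CompleteSpace E] {g : ℝ → E} (hg : Integrable g)
    (h : 𝓕 g = 0) : ∀ᵐ x, g x = 0 := by
  refine ae_eq_zero_of_integral_contDiff_smul_eq_zero hg.locallyIntegrable fun φ hφ hφc => ?_
  let Φ : SchwartzMap ℝ ℂ :=
    (hφc.comp_left (g := ((↑) : ℝ → ℂ)) rfl).toSchwartzMap (ofRealCLM.contDiff.comp hφ)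
  let ψ : SchwartzMap ℝ ℂ := 𝓕⁻ Φ
  have hψ : 𝓕 (ψ : ℝ → ℂ) = fun x => (φ x : ℂ) := by
    rw [← SchwartzMap.fourier_coe, FourierTransform.fourier_fourierInv_eq]
    rfl
  have hself := VectorFourier.integral_fourierIntegral_smul_eq_flip (L := innerₗ ℝ)
    (μ := volume) (ν := volume) Real.continuous_fourierChar continuous_inner ψ.integrable hg
  rw [flip_innerₗ] at hself
  change ∫ x, 𝓕 (ψ : ℝ → ℂ) x • g x = ∫ x, ψ x • 𝓕 g x at hself
  simpa [hψ, h] using hself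

lemma fourier_indicator_exp_smul (u : ℝ → E) (ξ : ℝ) :
    𝓕 ((Ici (0 : ℝ)).indicator fun t : ℝ => exp (-((1 : ℂ) * t)) • u t) ξ =
      laplaceTransform u (1 + 2 * Real.pi * ξ * I) := by
  rw [Real.fourier_real_eq_integral_exp_smul, laplaceTransform, timeMeasure,
    ← integral_indicator measurableSet_Ici]
  congr 1 with t
  by_cases ht : t ∈ Ici (0 : ℝ)
  · simp only [indicator_of_mem ht, smul_smul, ← exp_add]
    congr 2
    push_cast
    ring
  · simp only [indicator_of_notMem ht, smul_zero]

lemma ae_eq_of_laplaceTransform_eq [CompleteSpace E] {u v : ℝ → E}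
    (hu : MemLp u 2 timeMeasure) (hv : MemLp v 2 timeMeasure)
    (h : ∀ s : ℂ, 0 < s.re → laplaceTransform u s = laplaceTransform v s) :
    u =ᵐ[timeMeasure] v := by
  have hint : Integrable ((Ici (0 : ℝ)).indicator fun t : ℝ => exp (-((1 : ℂ) * t)) • (u - v) t) :=
    (integrable_indicator_iff measurableSet_Ici).2
      (integrable_exp_smul_of_memLp_two (hu.sub hv) (by simp))
  have hzero := ae_eq_zero_of_fourier_eq_zero hint <| funext fun ξ => by
    rw [fourier_indicator_exp_smul, laplaceTransform_sub hu hv (by simp), h _ (by simp), sub_self,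
      Pi.zero_apply]
  rw [timeMeasure, Filter.EventuallyEq, ae_restrict_iff' measurableSet_Ici]
  filter_upwards [hzero] with t ht hmem
  simpa [indicator_of_mem hmem, sub_eq_zero] using ht

end Laplace

section YoungInequality

open MeasureTheory Measure Convolution

lemma rpow_lintegral_mul_le {α : Type*} [MeasurableSpace α] {μ : Measure α} {p : ℝ} (hp : 1 ≤ p)
    {a b : α → ℝ≥0∞} (ha : AEMeasurable a μ) (hb : AEMeasurable b μ) :
    (∫⁻ x, a x * b x ∂μ) ^ p ≤ (∫⁻ x, a x ∂μ) ^ (p - 1) * ∫⁻ x, a x * b x ^ p ∂μ := by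
  have hp₀ : 0 < p := zero_lt_one.trans_le hp
  have hq : 0 ≤ 1 - 1 / p := sub_nonneg.2 ((div_le_one hp₀).2 hp)
  have hsplit : ∀ x, a x * b x = a x ^ (1 - 1 / p) * (a x * b x ^ p) ^ (1 / p) := fun x => by
    rw [ENNReal.mul_rpow_of_nonneg _ _ (by positivity), ← mul_assoc,
      ← ENNReal.rpow_add_of_nonneg _ _ hq (by positivity), sub_add_cancel, ENNReal.rpow_one,
      ← ENNReal.rpow_mul, mul_one_div_cancel hp₀.ne', ENNReal.rpow_one]
  calc (∫⁻ x, a x * b x ∂μ) ^ p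
      = (∫⁻ x, a x ^ (1 - 1 / p) * (a x * b x ^ p) ^ (1 / p) ∂μ) ^ p := by simp only [← hsplit]
    _ ≤ ((∫⁻ x, a x ∂μ) ^ (1 - 1 / p) * (∫⁻ x, a x * b x ^ p ∂μ) ^ (1 / p)) ^ p := by
        gcongr
        exact ENNReal.lintegral_mul_norm_pow_le ha (ha.mul (hb.pow_const p)) hq (by positivity)
          (sub_add_cancel _ _)
    _ = _ := by
        rw [ENNReal.mul_rpow_of_nonneg _ _ hp₀.le, ← ENNReal.rpow_mul, ← ENNReal.rpow_mul,
          one_div_mul_cancel hp₀.ne', ENNReal.rpow_one, sub_mul, one_div_mul_cancel hp₀.ne',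
          one_mul]

variable {G : Type*} [AddGroup G] [MeasurableSpace G] [MeasurableAdd₂ G] [MeasurableNeg G]
  {μ : Measure G} [SFinite μ] [μ.IsAddRightInvariant]

lemma lintegral_rpow_lintegral_mul_sub_le {p : ℝ} (hp : 1 ≤ p) {a b : G → ℝ≥0∞}
    (ha : AEMeasurable a μ) (hb : AEMeasurable b μ) :
    ∫⁻ x, (∫⁻ t, a t * b (x - t) ∂μ) ^ p ∂μ ≤ (∫⁻ t, a t ∂μ) ^ p * ∫⁻ x, b x ^ p ∂μ := by
  have hprod : AEMeasurable (fun z : G × G => a z.2 * b (z.1 - z.2) ^ p) (μ.prod μ) :=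
    ha.comp_snd.mul ((hb.comp_quasiMeasurePreserving
      (quasiMeasurePreserving_sub_of_right_invariant μ μ)).pow_const p)
  calc ∫⁻ x, (∫⁻ t, a t * b (x - t) ∂μ) ^ p ∂μ
      ≤ ∫⁻ x, (∫⁻ t, a t ∂μ) ^ (p - 1) * ∫⁻ t, a t * b (x - t) ^ p ∂μ ∂μ :=
        lintegral_mono fun x => rpow_lintegral_mul_le hp ha <|
          hb.comp_quasiMeasurePreserving (quasiMeasurePreserving_sub_left_of_right_invariant μ x)
    _ = (∫⁻ t, a t ∂μ) ^ (p - 1) * ∫⁻ x, ∫⁻ t, a t * b (x - t) ^ p ∂μ ∂μ :=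
        lintegral_const_mul'' _ hprod.lintegral_prod_right'
    _ = (∫⁻ t, a t ∂μ) ^ (p - 1) * ∫⁻ t, ∫⁻ x, a t * b (x - t) ^ p ∂μ ∂μ := by
        rw [lintegral_lintegral_swap hprod]
    _ = (∫⁻ t, a t ∂μ) ^ (p - 1) * ∫⁻ t, a t * ∫⁻ x, b x ^ p ∂μ ∂μ := by
        congr 1
        refine lintegral_congr fun t => ?_
        have hshift : AEMeasurable (fun x => b (x - t) ^ p) μ :=
          (hb.comp_quasiMeasurePreserving
            (measurePreserving_sub_right μ t).quasiMeasurePreserving).pow_const p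
        rw [lintegral_const_mul'' _ hshift, lintegral_sub_right_eq_self (fun x => b x ^ p) t]
    _ = (∫⁻ t, a t ∂μ) ^ p * ∫⁻ x, b x ^ p ∂μ := by
        rw [lintegral_mul_const'' _ ha, ← mul_assoc]
        nth_rw 2 [← ENNReal.rpow_one (∫⁻ t, a t ∂μ)]
        rw [← ENNReal.rpow_add_of_nonneg _ _ (by linarith) zero_le_one, sub_add_cancel]

theorem eLpNorm_convolution_le {𝕜 E E' F : Type*} [NontriviallyNormedField 𝕜]
    [NormedAddCommGroup E] [NormedAddCommGroup E'] [NormedAddCommGroup F] [NormedSpace 𝕜 E]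
    [NormedSpace 𝕜 E'] [NormedSpace 𝕜 F] [NormedSpace ℝ F] (L : E →L[𝕜] E' →L[𝕜] F)
    {p : ℝ≥0∞} (hp : 1 ≤ p) (hp' : p ≠ ∞) {f : G → E} {g : G → E'}
    (hf : AEStronglyMeasurable f μ) (hg : AEStronglyMeasurable g μ) :
    eLpNorm (f ⋆[L, μ] g) p μ ≤ ‖L‖ₑ * eLpNorm f 1 μ * eLpNorm g p μ := by
  have hp₀ : p ≠ 0 := (zero_lt_one.trans_le hp).ne'
  have hpos : 0 < p.toReal := ENNReal.toReal_pos hp₀ hp'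
  have hone : 1 ≤ p.toReal := by simpa using ENNReal.toReal_mono hp' hp
  have hpointwise : ∀ x, ‖(f ⋆[L, μ] g) x‖ₑ ≤ ∫⁻ t, ‖L‖ₑ * ‖f t‖ₑ * ‖g (x - t)‖ₑ ∂μ := fun x =>
    (enorm_integral_le_lintegral_enorm _).trans (lintegral_mono fun t => L.le_opENorm₂ _ _)
  rw [eLpNorm_eq_lintegral_rpow_enorm_toReal hp₀ hp',
    eLpNorm_eq_lintegral_rpow_enorm_toReal hp₀ hp', eLpNorm_one_eq_lintegral_enorm,
    ← lintegral_const_mul'' _ hf.enorm, one_div,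
    ENNReal.rpow_inv_le_iff hpos, ENNReal.mul_rpow_of_nonneg _ _ hpos.le,
    ENNReal.rpow_inv_rpow hpos.ne']
  calc ∫⁻ x, ‖(f ⋆[L, μ] g) x‖ₑ ^ p.toReal ∂μ
      ≤ ∫⁻ x, (∫⁻ t, ‖L‖ₑ * ‖f t‖ₑ * ‖g (x - t)‖ₑ ∂μ) ^ p.toReal ∂μ := by
        gcongr with x
        exact hpointwise x
    _ ≤ _ := lintegral_rpow_lintegral_mul_sub_le hone (hf.enorm.const_mul _) hg.enorm

end YoungInequality

section CausalConvolution

open Complex MeasureTheory Set Convolution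

lemma timeMeasure_eq_restrict_Ioi : timeMeasure = volume.restrict (Ioi 0) :=
  Measure.restrict_congr_set Ioi_ae_eq_Ici.symm

section Young

variable {E E' F : Type*} [NormedAddCommGroup E] [NormedAddCommGroup E'] [NormedAddCommGroup F]
  [NormedSpace ℝ E] [NormedSpace ℝ E'] [NormedSpace ℝ F] (L : E →L[ℝ] E' →L[ℝ] F)
  {k : ℝ → E} {u : ℝ → E'}

lemma aestronglyMeasurable_posConvolution (hk : AEStronglyMeasurable k timeMeasure)
    (hu : AEStronglyMeasurable u timeMeasure) :
    AEStronglyMeasurable (posConvolution k u L) timeMeasure := by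
  rw [timeMeasure_eq_restrict_Ioi] at *
  rw [← aestronglyMeasurable_indicator_iff measurableSet_Ioi] at hk hu
  rw [posConvolution_eq_convolution_indicator k u L volume]
  exact (hk.convolution_integrand L hu).integral_prod_right'.restrict

lemma eLpNorm_posConvolution_le {p : ℝ≥0∞} (hp : 1 ≤ p) (hp' : p ≠ ∞)
    (hk : AEStronglyMeasurable k timeMeasure) (hu : AEStronglyMeasurable u timeMeasure) :
    eLpNorm (posConvolution k u L) p timeMeasure ≤
      ‖L‖ₑ * eLpNorm k 1 timeMeasure * eLpNorm u p timeMeasure := by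
  rw [timeMeasure_eq_restrict_Ioi] at *
  rw [← aestronglyMeasurable_indicator_iff measurableSet_Ioi] at hk hu
  rw [posConvolution_eq_convolution_indicator k u L volume,
    ← eLpNorm_indicator_eq_eLpNorm_restrict (f := k) measurableSet_Ioi,
    ← eLpNorm_indicator_eq_eLpNorm_restrict (f := u) measurableSet_Ioi]
  exact (eLpNorm_restrict_le _ _ _ _).trans (eLpNorm_convolution_le L hp hp' hk hu)

end Young

variable {E : Type*} [NormedAddCommGroup E] [NormedSpace ℂ E]

lemma integrable_exp_smul {u : ℝ → E} (hu : Integrable u timeMeasure) {s : ℂ} (hs : 0 ≤ s.re) :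
    Integrable (fun t : ℝ => exp (-(s * (t : ℂ))) • u t) timeMeasure := by
  refine hu.bdd_smul 1 (by fun_prop) ?_
  rw [timeMeasure]
  filter_upwards [ae_restrict_mem measurableSet_Ici] with t ht
  simpa [norm_exp] using mul_nonneg hs ht

lemma laplaceTransform_posConvolution [CompleteSpace E] {k : ℝ → ℂ} {u : ℝ → E} {s : ℂ}
    (hk : Integrable (fun t : ℝ => exp (-(s * (t : ℂ))) • k t) timeMeasure)
    (hu : Integrable (fun t : ℝ => exp (-(s * (t : ℂ))) • u t) timeMeasure) :
    laplaceTransform (posConvolution k u (ContinuousLinearMap.lsmul ℝ ℂ)) s =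
      laplaceTransform k s • laplaceTransform u s := by
  simp only [laplaceTransform, timeMeasure_eq_restrict_Ioi] at *
  have hint := integral_posConvolution hk hu (ContinuousLinearMap.lsmul ℝ ℂ)
  rw [ContinuousLinearMap.lsmul_apply] at hint
  rw [← hint]
  refine setIntegral_congr_fun measurableSet_Ioi fun x hx => ?_
  simp only [posConvolution, indicator_of_mem hx, ContinuousLinearMap.lsmul_apply,
    ← intervalIntegral.integral_smul]
  refine intervalIntegral.integral_congr fun t _ => ?_
  simp only [smul_smul, smul_eq_mul]
  rw [mul_right_comm, ← exp_add]
  congr 3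
  push_cast
  ring

lemma integrable_exp_mul_timeMeasure {a : ℂ} (ha : a.re < 0) :
    Integrable (fun t : ℝ => exp (a * t)) timeMeasure := by
  rw [timeMeasure_eq_restrict_Ioi]
  exact integrableOn_exp_mul_complex_Ioi ha 0

lemma laplaceTransform_exp_mul {a s : ℂ} (h : a.re < s.re) :
    laplaceTransform (fun t : ℝ => exp (a * t)) s = (s - a)⁻¹ := by
  simp only [laplaceTransform, timeMeasure_eq_restrict_Ioi, smul_eq_mul, ← exp_add,
    ← neg_mul, ← add_mul]
  rw [integral_exp_mul_complex_Ioi (by simpa)]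
  rw [ofReal_zero, mul_zero, exp_zero, neg_div, one_div, ← inv_neg, neg_add, neg_neg,
    ← sub_eq_add_neg]

end CausalConvolution

section Multipliers

open Complex MeasureTheory Polynomial

lemma eval_div_prod_X_sub_C_mem {K : Type*} [Field K] {Ω : Set K} {A : Subalgebra K (Ω → K)}
    (hA : ∀ a ∉ Ω, (fun s : Ω => ((s : K) - a)⁻¹) ∈ A) (R : Multiset K) (hR : ∀ a ∈ R, a ∉ Ω)
    {p : K[X]} (hp : p.natDegree ≤ R.card) :
    (fun s : Ω => p.eval (s : K) / (R.map fun a => (s : K) - a).prod) ∈ A := by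
  induction R using Multiset.induction_on generalizing p with
  | empty =>
    rw [eq_C_of_natDegree_eq_zero (Nat.le_zero.1 hp)]
    simp only [eval_C, Multiset.map_zero, Multiset.prod_zero, div_one]
    exact A.algebraMap_mem (p.coeff 0)
  | cons a R ih =>
    have ih := fun p => ih (p := p) fun b hb => hR b (Multiset.mem_cons_of_mem hb)
    have ha : a ∉ Ω := hR a (Multiset.mem_cons_self a R)
    have hdeg : (p /ₘ (X - C a)).natDegree ≤ R.card := by
      rw [natDegree_divByMonic _ (monic_X_sub_C a), natDegree_X_sub_C]
      rw [Multiset.card_cons] at hp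
      omega
    convert A.add_mem (ih _ hdeg)
      (A.smul_mem (A.mul_mem (hA a ha) (ih 1 (by simp))) (p.eval a)) using 1
    ext s
    have hne : (s : K) - a ≠ 0 := sub_ne_zero.2 fun h => ha (h ▸ s.2)
    have hdivision := congrArg (eval (s : K)) (modByMonic_add_div p (X - C a))
    simp only [modByMonic_X_sub_C_eq_C_eval, eval_add, eval_mul, eval_sub, eval_C, eval_X]
      at hdivision
    simp only [Multiset.map_cons, Multiset.prod_cons, Pi.add_apply, Pi.smul_apply, Pi.mul_apply,
      smul_eq_mul, eval_one, ← hdivision, add_div, mul_div_mul_left _ _ hne]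
    rw [add_comm, ← div_div]
    ring

lemma eval_div_eval_mem {K : Type*} [Field K] {Ω : Set K} {A : Subalgebra K (Ω → K)}
    (hA : ∀ a ∉ Ω, (fun s : Ω => ((s : K) - a)⁻¹) ∈ A) {p q : K[X]}
    (hpq : p.natDegree ≤ q.natDegree) (hq : q.Splits) (hq₀ : ∀ s ∈ Ω, q.eval s ≠ 0) :
    (fun s : Ω => p.eval (s : K) / q.eval (s : K)) ∈ A := by
  have hroots : ∀ a ∈ q.roots, a ∉ Ω := fun a ha hmem => hq₀ a hmem (isRoot_of_mem_roots ha)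
  rw [hq.natDegree_eq_card_roots] at hpq
  convert A.smul_mem (eval_div_prod_X_sub_C_mem hA q.roots hroots hpq) q.leadingCoeff⁻¹ using 1
  ext s
  conv_lhs => rw [hq.eq_prod_roots]
  simp [eval_multiset_prod, div_eq_mul_inv, mul_left_comm, mul_comm]

variable (E : Type*) [NormedAddCommGroup E] [NormedSpace ℂ E]

/-- The algebra of operator-valued functions on the right half-plane by which the Laplace
transform of every `L₂` signal may be multiplied to give the transform of an `L₂` signal, with a
uniform bound on the norms. Only the values on `Re s > 0` are constrained. -/
noncomputable def l2Multiplier : Subalgebra ℂ (closedRHP → E →L[ℂ] E) where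
  carrier := {Φ | ∃ C : ℝ≥0, ∀ u : ℝ → E, MemLp u 2 timeMeasure →
    ∃ y : ℝ → E, MemLp y 2 timeMeasure ∧ eLpNorm y 2 timeMeasure ≤ C * eLpNorm u 2 timeMeasure ∧
      ∀ s : closedRHP, 0 < (s : ℂ).re → laplaceTransform y s = Φ s (laplaceTransform u s)}
  mul_mem' := by
    rintro Φ Ψ ⟨C, hΦ⟩ ⟨D, hΨ⟩
    refine ⟨C * D, fun u hu => ?_⟩
    obtain ⟨v, hv, hvu, hv'⟩ := hΨ u hu
    obtain ⟨y, hy, hyv, hy'⟩ := hΦ v hv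
    refine ⟨y, hy, ?_, fun s hs => by rw [hy' s hs, hv' s hs]; rfl⟩
    rw [ENNReal.coe_mul, mul_assoc]
    exact hyv.trans (by gcongr)
  add_mem' := by
    rintro Φ Ψ ⟨C, hΦ⟩ ⟨D, hΨ⟩
    refine ⟨C + D, fun u hu => ?_⟩
    obtain ⟨y, hy, hyu, hy'⟩ := hΦ u hu
    obtain ⟨z, hz, hzu, hz'⟩ := hΨ u hu
    refine ⟨y + z, hy.add hz, ?_, fun s hs => by
      rw [laplaceTransform_add hy hz hs, hy' s hs, hz' s hs]; rfl⟩
    rw [ENNReal.coe_add, add_mul]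
    exact (eLpNorm_add_le hy.1 hz.1 one_le_two).trans (add_le_add hyu hzu)
  algebraMap_mem' c :=
    ⟨‖c‖₊, fun u hu => ⟨c • u, hu.const_smul c, eLpNorm_const_smul_le, fun s _ =>
      laplaceTransform_smul c u s⟩⟩

variable {E} [CompleteSpace E]

lemma const_mem_l2Multiplier (T : E →L[ℂ] E) : (fun _ => T) ∈ l2Multiplier E :=
  ⟨‖T‖₊, fun u hu => ⟨T ∘ u, T.comp_memLp' hu,
    eLpNorm_le_nnreal_smul_eLpNorm_of_ae_le_mul (ae_of_all _ fun t => T.le_opNNNorm (u t)) 2,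
    fun _ hs => laplaceTransform_clm_comp T hu hs⟩⟩

lemma laplaceTransform_smul_one_mem_l2Multiplier {k : ℝ → ℂ} (hk : Integrable k timeMeasure) :
    (fun s : closedRHP => laplaceTransform k s • (1 : E →L[ℂ] E)) ∈ l2Multiplier E := by
  have hk₁ := memLp_one_iff_integrable.2 hk
  refine ⟨(eLpNorm k 1 timeMeasure).toNNReal, fun u hu => ?_⟩
  rw [ENNReal.coe_toNNReal hk₁.2.ne]
  have hle : eLpNorm (posConvolution k u (ContinuousLinearMap.lsmul ℝ ℂ)) 2 timeMeasure ≤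
      eLpNorm k 1 timeMeasure * eLpNorm u 2 timeMeasure := by
    refine (eLpNorm_posConvolution_le _ one_le_two ENNReal.ofNat_ne_top hk₁.1 hu.1).trans ?_
    gcongr
    refine mul_le_of_le_one_left' ?_
    rw [← ofReal_norm, ENNReal.ofReal_le_one]
    exact ContinuousLinearMap.opNorm_lsmul_le
  exact ⟨_, ⟨aestronglyMeasurable_posConvolution _ hk₁.1 hu.1,
    hle.trans_lt (ENNReal.mul_lt_top hk₁.2 hu.2)⟩, hle, fun s hs =>
    laplaceTransform_posConvolution (integrable_exp_smul hk s.2)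
      (integrable_exp_smul_of_memLp_two hu hs)⟩

lemma eval_smul_one_mem_l2Multiplier (r : RHInf) :
    (fun s : closedRHP => evalHom r s • (1 : E →L[ℂ] E)) ∈ l2Multiplier E := by
  let A : Subalgebra ℂ (closedRHP → ℂ) :=
    (l2Multiplier E).comap ((Algebra.ofId ℂ (E →L[ℂ] E)).compLeft closedRHP)
  have hA : ∀ a ∉ closedRHP, (fun s : closedRHP => ((s : ℂ) - a)⁻¹) ∈ A := fun a ha => by
    have hre : a.re < 0 := not_le.1 ha
    have hmem := laplaceTransform_smul_one_mem_l2Multiplier (E := E)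
      (integrable_exp_mul_timeMeasure hre)
    have htransform (s : closedRHP) :
        laplaceTransform (fun t : ℝ => exp (a * t)) s = ((s : ℂ) - a)⁻¹ :=
      laplaceTransform_exp_mul (hre.trans_le s.2)
    simp only [htransform, ← Algebra.algebraMap_eq_smul_one] at hmem
    exact hmem
  have hmem := eval_div_eval_mem hA (p := (r : RatFunc ℝ).num.map (algebraMap ℝ ℂ))
    (q := (r : RatFunc ℝ).denom.map (algebraMap ℝ ℂ)) (by simpa using r.2.1)
    (IsAlgClosed.splits _) fun s hs => by simpa [aeval_def, eval_map] using r.2.2 s hs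
  simp only [← Algebra.algebraMap_eq_smul_one, evalHom_coe, RatFunc.eval, eval₂_eq_eval_map]
  exact hmem

end Multipliers

section Responses

open Complex MeasureTheory ComplexConjugate

variable {n : ℕ}

/-- The value of a matrix over `RH∞` at a point of the compactified closed right half-plane, as an
operator on `ℂⁿ`. -/
noncomputable def operatorAt (z : OnePoint closedRHP) : Matrix (Fin n) (Fin n) RHInf →+*
    (EuclideanSpace ℂ (Fin n) →L[ℂ] EuclideanSpace ℂ (Fin n)) :=
  (Matrix.toEuclideanCLM : Matrix (Fin n) (Fin n) ℂ ≃⋆ₐ[ℂ] _).toRingEquiv.toRingHom.comp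
    (valueAt z).toRingHom.mapMatrix

lemma operatorAt_apply (z : OnePoint closedRHP) (M : Matrix (Fin n) (Fin n) RHInf)
    (v : EuclideanSpace ℂ (Fin n)) (i : Fin n) :
    operatorAt z M v i = ∑ j, evalHom (M i j) z * v j := rfl

lemma operatorAt_mem_l2Multiplier (M : Matrix (Fin n) (Fin n) RHInf) :
    (fun s : closedRHP => operatorAt s M) ∈
      l2Multiplier (EuclideanSpace ℂ (Fin n)) := by
  let T (i j : Fin n) : EuclideanSpace ℂ (Fin n) →L[ℂ] EuclideanSpace ℂ (Fin n) :=
    Matrix.toEuclideanCLM (n := Fin n) (𝕜 := ℂ) (Matrix.single i j 1)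
  have hsum : (fun s : closedRHP => operatorAt s M) =
      ∑ i, ∑ j, (fun s : closedRHP => evalHom (M i j) s • 1) * fun _ => T i j := by
    ext1 s
    change Matrix.toEuclideanCLM (n := Fin n) (𝕜 := ℂ) (M.map (valueAt s)) = _
    rw [Matrix.matrix_eq_sum_single (M.map (valueAt s))]
    simp only [map_sum, Finset.sum_apply, Pi.mul_apply, smul_mul_assoc, one_mul, T, ← map_smul,
      Matrix.smul_single, smul_eq_mul, mul_one]
    rfl
  rw [hsum]
  exact sum_mem fun i _ => sum_mem fun j _ =>
    mul_mem (eval_smul_one_mem_l2Multiplier (M i j)) (const_mem_l2Multiplier (T i j))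

/-- Componentwise complex conjugation on `ℂⁿ`. -/
noncomputable def conjVec : EuclideanSpace ℂ (Fin n) ≃L[ℝ] EuclideanSpace ℂ (Fin n) :=
  (LinearIsometryEquiv.piLpCongrRight 2 fun _ => conjLIE).toContinuousLinearEquiv

lemma conjVec_apply (v : EuclideanSpace ℂ (Fin n)) (i : Fin n) : conjVec v i = conj (v i) := rfl

lemma laplaceTransform_conjVec (u : ℝ → EuclideanSpace ℂ (Fin n)) (s : ℂ) :
    laplaceTransform (conjVec ∘ u) s = conjVec (laplaceTransform u (conj s)) := by
  refine Eq.trans ?_ (conjVec.integral_comp_comm _)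
  refine integral_congr_ae (ae_of_all _ fun t => ?_)
  ext i
  simp [conjVec_apply, ← exp_conj]

lemma conjVec_operatorAt (s : ℂ) (hs : s ∈ closedRHP) (hs' : conj s ∈ closedRHP)
    (M : Matrix (Fin n) (Fin n) RHInf) (v : EuclideanSpace ℂ (Fin n)) :
    conjVec (operatorAt ((⟨conj s, hs'⟩ : closedRHP) : OnePoint closedRHP) M v) =
      operatorAt ((⟨s, hs⟩ : closedRHP) : OnePoint closedRHP) M (conjVec v) := by
  ext i
  simp only [conjVec_apply, operatorAt_apply, map_sum, map_mul]
  refine Finset.sum_congr rfl fun j _ => ?_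
  rw [evalHom_coe, evalHom_coe, eval_conj, conj_conj]

/-- The componentwise map `Kⁿ → Lⁿ` between real or complex spaces: the inclusion when `K ⊆ L`,
the real part when `K = ℂ` and `L = ℝ`. -/
noncomputable def mapVec (K L : Type*) [RCLike K] [RCLike L] :
    EuclideanSpace K (Fin n) →L[ℝ] EuclideanSpace L (Fin n) :=
  (PiLp.continuousLinearEquiv 2 ℝ fun _ : Fin n => L).symm ∘L
    .pi fun i => RCLike.map K L ∘L PiLp.proj 2 (fun _ : Fin n => K) i

lemma mapVec_apply {K L : Type*} [RCLike K] [RCLike L] (v : EuclideanSpace K (Fin n)) (i : Fin n) :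
    mapVec K L v i = RCLike.re (v i) + RCLike.im (v i) * (RCLike.I : L) := rfl

variable {F : Type} [RCLike F]

lemma mapVec_mapVec_complex (v : EuclideanSpace F (Fin n)) : mapVec ℂ F (mapVec F ℂ v) = v := by
  ext i
  simp [mapVec_apply]

lemma conjVec_mapVec_of_I_eq_zero (hI : (RCLike.I : F) = 0) (v : EuclideanSpace F (Fin n)) :
    conjVec (mapVec F ℂ v) = mapVec F ℂ v := by
  ext i
  have him : RCLike.im (v i) = 0 := by rw [← RCLike.re_add_im (v i), hI]; simp
  simp [conjVec_apply, mapVec_apply, him]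

lemma mapVec_mapVec_of_I_eq_zero (hI : (RCLike.I : F) = 0) (v : EuclideanSpace ℂ (Fin n)) :
    mapVec F ℂ (mapVec ℂ F v) = (1 / 2 : ℂ) • (v + conjVec v) := by
  ext i
  simp [conjVec_apply, mapVec_apply, hI, re_eq_add_conj, div_eq_inv_mul, mul_add]

lemma mapVec_mapVec_of_im_I_eq_one (hI : RCLike.im (RCLike.I : F) = 1)
    (v : EuclideanSpace ℂ (Fin n)) : mapVec F ℂ (mapVec ℂ F v) = v := by
  ext i
  simp [mapVec_apply, hI]

lemma memLp_mapVec_comp {K L : Type*} [RCLike K] [RCLike L] {u : ℝ → EuclideanSpace K (Fin n)}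
    (hu : MemLp u 2 timeMeasure) : MemLp (mapVec K L ∘ u) 2 timeMeasure :=
  (mapVec K L).comp_memLp' hu

lemma eLpNorm_mapVec_comp_le {K L : Type*} [RCLike K] [RCLike L]
    (u : ℝ → EuclideanSpace K (Fin n)) :
    eLpNorm (mapVec K L ∘ u) 2 timeMeasure ≤
      ‖(mapVec K L : EuclideanSpace K (Fin n) →L[ℝ] _)‖₊ * eLpNorm u 2 timeMeasure :=
  eLpNorm_le_nnreal_smul_eLpNorm_of_ae_le_mul
    (ae_of_all _ fun t => (mapVec K L).le_opNNNorm (u t)) 2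

lemma laplace_eq_laplaceTransform (u : ℝ → EuclideanSpace F (Fin n)) :
    laplace u = laplaceTransform (mapVec F ℂ ∘ u) := rfl

lemma isResponse_toTransferMatrix_iff {M : Matrix (Fin n) (Fin n) RHInf}
    {u y : ℝ → EuclideanSpace F (Fin n)} :
    IsResponse (toTransferMatrix M) u y ↔ ∀ s : closedRHP, 0 < (s : ℂ).re →
      laplace y s = operatorAt s M (laplace u s) :=
  ⟨fun h s hs => h s hs, fun h s hs => h ⟨s, hs.le⟩ hs⟩

lemma laplaceTransform_conjVec_of_I_eq_zero (hI : (RCLike.I : F) = 0)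
    {M : Matrix (Fin n) (Fin n) RHInf} {u : ℝ → EuclideanSpace F (Fin n)}
    {Y : ℝ → EuclideanSpace ℂ (Fin n)}
    (hY : ∀ s : closedRHP, 0 < (s : ℂ).re →
      laplaceTransform Y s = operatorAt s M (laplace u s))
    {s : closedRHP} (hs : 0 < (s : ℂ).re) :
    laplaceTransform (conjVec ∘ Y) s = operatorAt s M (laplace u s) := by
  have hs' : 0 < (conj (s : ℂ)).re := by rwa [conj_re]
  have hu : conjVec ∘ mapVec F ℂ ∘ u = mapVec F ℂ ∘ u :=
    funext fun t => conjVec_mapVec_of_I_eq_zero hI (u t)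
  rw [laplaceTransform_conjVec, hY ⟨conj s, hs'.le⟩ hs', conjVec_operatorAt _ s.2,
    laplace_eq_laplaceTransform, ← laplaceTransform_conjVec, hu]

-- For real signals, `conj ∘ Y` has the same transform as `Y`, hence so does its real part.
lemma isResponse_mapVec_comp {M : Matrix (Fin n) (Fin n) RHInf} {u : ℝ → EuclideanSpace F (Fin n)}
    {Y : ℝ → EuclideanSpace ℂ (Fin n)} (hYmem : MemLp Y 2 timeMeasure)
    (hY : ∀ s : closedRHP, 0 < (s : ℂ).re →
      laplaceTransform Y s = operatorAt s M (laplace u s)) :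
    IsResponse (toTransferMatrix M) u (mapVec ℂ F ∘ Y) := by
  refine isResponse_toTransferMatrix_iff.2 fun s hs => ?_
  rw [laplace_eq_laplaceTransform]
  rcases RCLike.I_eq_zero_or_im_I_eq_one (K := F) with hI | hI
  · have hre : mapVec F ℂ ∘ mapVec ℂ F ∘ Y = (1 / 2 : ℂ) • (Y + conjVec ∘ Y) :=
      funext fun t => mapVec_mapVec_of_I_eq_zero hI (Y t)
    have hconj : MemLp (conjVec ∘ Y) 2 timeMeasure :=
      conjVec.toContinuousLinearMap.comp_memLp' hYmem
    rw [hre, laplaceTransform_smul, laplaceTransform_add hYmem hconj hs,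
      laplaceTransform_conjVec_of_I_eq_zero hI hY hs, hY s hs, ← two_smul ℂ, smul_smul,
      one_div, inv_mul_cancel₀ two_ne_zero, one_smul]
  · have hid : mapVec F ℂ ∘ mapVec ℂ F ∘ Y = Y :=
      funext fun t => mapVec_mapVec_of_im_I_eq_one hI (Y t)
    rw [hid, hY s hs]

theorem exists_isResponse (F : Type) [RCLike F] (M : Matrix (Fin n) (Fin n) RHInf) :
    ∃ C : ℝ≥0, ∀ u : ℝ → EuclideanSpace F (Fin n), MemLp u 2 timeMeasure →
      ∃ y : ℝ → EuclideanSpace F (Fin n), MemLp y 2 timeMeasure ∧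
        eLpNorm y 2 timeMeasure ≤ C * eLpNorm u 2 timeMeasure ∧
        IsResponse (toTransferMatrix M) u y := by
  obtain ⟨C, hC⟩ := operatorAt_mem_l2Multiplier M
  let ι : EuclideanSpace F (Fin n) →L[ℝ] EuclideanSpace ℂ (Fin n) := mapVec F ℂ
  let ρ : EuclideanSpace ℂ (Fin n) →L[ℝ] EuclideanSpace F (Fin n) := mapVec ℂ F
  refine ⟨‖ρ‖₊ * (C * ‖ι‖₊), fun u hu => ?_⟩
  obtain ⟨Y, hYmem, hYle, hY⟩ := hC (ι ∘ u) (memLp_mapVec_comp hu)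
  refine ⟨ρ ∘ Y, memLp_mapVec_comp hYmem, ?_, isResponse_mapVec_comp hYmem hY⟩
  calc eLpNorm (ρ ∘ Y) 2 timeMeasure ≤ ‖ρ‖₊ * eLpNorm Y 2 timeMeasure := eLpNorm_mapVec_comp_le Y
    _ ≤ ‖ρ‖₊ * (C * eLpNorm (ι ∘ u) 2 timeMeasure) := by gcongr
    _ ≤ ‖ρ‖₊ * (C * (‖ι‖₊ * eLpNorm u 2 timeMeasure)) := by
      gcongr; exact eLpNorm_mapVec_comp_le u
    _ = _ := by simp only [ENNReal.coe_mul, mul_assoc]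

end Responses

section ClosedLoop

open MeasureTheory

variable {F : Type} [RCLike F] {n : ℕ} {u e y v w : ℝ → EuclideanSpace F (Fin n)}

lemma laplace_sub (hu : MemLp u 2 timeMeasure) (hv : MemLp v 2 timeMeasure) {s : ℂ}
    (hs : 0 < s.re) : laplace (u - v) s = laplace u s - laplace v s := by
  have hsub : mapVec F ℂ ∘ (u - v) = mapVec F ℂ ∘ u - mapVec F ℂ ∘ v :=
    funext fun t => map_sub (mapVec F ℂ) (u t) (v t)
  simp only [laplace_eq_laplaceTransform, hsub]
  exact laplaceTransform_sub (memLp_mapVec_comp hu) (memLp_mapVec_comp hv) hs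

lemma laplace_congr_ae (h : u =ᵐ[timeMeasure] v) : laplace u = laplace v :=
  laplaceTransform_congr_ae (h.fun_comp (mapVec F ℂ))

lemma ae_eq_of_laplace_eq (hu : MemLp u 2 timeMeasure) (hv : MemLp v 2 timeMeasure)
    (h : ∀ s : ℂ, 0 < s.re → laplace u s = laplace v s) : u =ᵐ[timeMeasure] v := by
  filter_upwards [ae_eq_of_laplaceTransform_eq (memLp_mapVec_comp hu) (memLp_mapVec_comp hv) h]
    with t ht
  rw [← mapVec_mapVec_complex (u t), ← mapVec_mapVec_complex (v t)]
  exact congrArg (mapVec ℂ F) ht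

lemma IsResponse.congr_ae {H : TransferMatrix n} (hy : IsResponse H u y)
    (hu : u =ᵐ[timeMeasure] v) (hw : y =ᵐ[timeMeasure] w) : IsResponse H v w := by
  unfold IsResponse
  rw [← laplace_congr_ae hu, ← laplace_congr_ae hw]
  exact hy

lemma IsResponse.ae_eq {H : TransferMatrix n} (hy : IsResponse H u y) (hw : IsResponse H u w)
    (hymem : MemLp y 2 timeMeasure) (hwmem : MemLp w 2 timeMeasure) : y =ᵐ[timeMeasure] w :=
  ae_eq_of_laplace_eq hymem hwmem fun s hs => (hy s hs).trans (hw s hs).symm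

lemma isLoopSolution_iff_isResponse_sub {H₁ H₂ : TransferMatrix n}
    (hu : MemLp u 2 timeMeasure) :
    IsLoopSolution H₁ H₂ u e y ↔ MemLp e 2 timeMeasure ∧ MemLp y 2 timeMeasure ∧
      IsResponse H₁ e y ∧ IsResponse H₂ y (u - e) := by
  refine ⟨fun h => ⟨h.1, h.2, h.3, ?_⟩, fun ⟨he, hy, hforward, hfeedback⟩ =>
    ⟨he, hy, hforward, u - e, hu.sub he, hfeedback, ae_of_all _ fun t => ?_⟩⟩
  · obtain ⟨w, -, hw, hloop⟩ := h.feedback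
    refine hw.congr_ae .rfl ?_
    filter_upwards [hloop] with t ht
    simp [ht]
  · simp

variable {M₁ M₂ S : Matrix (Fin n) (Fin n) RHInf}

lemma isResponse_sub_iff (hS : S * (1 + M₂ * M₁) = 1) (hu : MemLp u 2 timeMeasure)
    (he : MemLp e 2 timeMeasure) (hy : IsResponse (toTransferMatrix M₁) e y) :
    IsResponse (toTransferMatrix M₂) y (u - e) ↔ IsResponse (toTransferMatrix S) u e := by
  rw [isResponse_toTransferMatrix_iff] at hy ⊢
  rw [isResponse_toTransferMatrix_iff]
  refine forall₂_congr fun s hs => ?_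
  have hreturn (v : EuclideanSpace ℂ (Fin n)) : operatorAt s (1 + M₂ * M₁) v =
      v + operatorAt s M₂ (operatorAt s M₁ v) := by
    simp
  have hleft := congrArg (operatorAt s) hS
  have hright := congrArg (operatorAt s) (mul_eq_one_comm.1 hS)
  rw [map_mul, map_one] at hleft hright
  rw [laplace_sub hu he hs, hy s hs, sub_eq_iff_eq_add', ← hreturn]
  constructor <;> intro h
  · rw [h, ← mul_apply_eq_comp, hleft, one_apply_eq_self]
  · rw [h, ← mul_apply_eq_comp, hright, one_apply_eq_self]

lemma isLoopSolution_toTransferMatrix_iff (hS : S * (1 + M₂ * M₁) = 1)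
    (hu : MemLp u 2 timeMeasure) :
    IsLoopSolution (toTransferMatrix M₁) (toTransferMatrix M₂) u e y ↔
      MemLp e 2 timeMeasure ∧ MemLp y 2 timeMeasure ∧
        IsResponse (toTransferMatrix M₁) e y ∧ IsResponse (toTransferMatrix S) u e :=
  (isLoopSolution_iff_isResponse_sub hu).trans <|
    and_congr_right fun he => and_congr_right fun _ => and_congr_right fun hy =>
      isResponse_sub_iff hS hu he hy

theorem isL2StableOver_of_isUnit (F : Type) [RCLike F] (h : IsUnit (1 + M₂ * M₁)) :
    IsL2StableOver F (toTransferMatrix M₁) (toTransferMatrix M₂) := by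
  obtain ⟨S, hS⟩ := h.exists_left_inv
  obtain ⟨C, hC⟩ := exists_isResponse F S
  obtain ⟨C₁, hC₁⟩ := exists_isResponse F M₁
  refine ⟨max C (C₁ * C), fun u hu => ?_⟩
  obtain ⟨e, he, he_le, hue⟩ := hC u hu
  obtain ⟨y, hy, hy_le, hey⟩ := hC₁ e he
  refine ⟨e, y, (isLoopSolution_toTransferMatrix_iff hS hu).2 ⟨he, hy, hey, hue⟩, ?_, ?_,
    fun e' y' hloop => ?_⟩
  · refine he_le.trans ?_
    gcongr
    exact le_max_left _ _
  · calc eLpNorm y 2 timeMeasure ≤ C₁ * (C * eLpNorm u 2 timeMeasure) := hy_le.trans (by gcongr)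
      _ = (C₁ * C : ℝ≥0) * eLpNorm u 2 timeMeasure := by rw [ENNReal.coe_mul, mul_assoc]
      _ ≤ _ := by gcongr; exact le_max_right _ _
  · obtain ⟨he', hy', hey', hue'⟩ := (isLoopSolution_toTransferMatrix_iff hS hu).1 hloop
    have hee' : e' =ᵐ[timeMeasure] e := hue'.ae_eq hue he' he
    exact ⟨hee', (hey'.congr_ae hee' .rfl).ae_eq hey hy' hy⟩

end ClosedLoop

end MixedGainPhase

theorem theorem5 (n : ℕ) (H₁ H₂ : MixedGainPhase.TransferMatrix n)
    (h₁ : MixedGainPhase.IsRHInf H₁) (h₂ : MixedGainPhase.IsRHInf H₂)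
    (h : ∀ ω : ENNReal,
      MixedGainPhase.alphaMax (MixedGainPhase.freqResponse H₁ ω) +
          MixedGainPhase.alphaMax (MixedGainPhase.freqResponse H₂ ω) < Real.pi ∨
      MixedGainPhase.sigmaMax (MixedGainPhase.freqResponse H₁ ω) *
          MixedGainPhase.sigmaMax (MixedGainPhase.freqResponse H₂ ω) < 1) :
    MixedGainPhase.IsClosedLoopL2Stable H₁ H₂ := by
  obtain ⟨M₁, rfl⟩ := MixedGainPhase.exists_toTransferMatrix_eq h₁
  obtain ⟨M₂, rfl⟩ := MixedGainPhase.exists_toTransferMatrix_eq h₂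
  have hunit : IsUnit (1 + M₂ * M₁) := MixedGainPhase.isUnit_one_add_mul h
  exact ⟨MixedGainPhase.isL2StableOver_of_isUnit ℝ hunit,
    MixedGainPhase.isL2StableOver_of_isUnit ℂ hunit⟩
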